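/- Let $(M,g)$ be a compact smooth Riemannian manifold without boundary, of dimension $n$, and let $(\varphi_j)_{j\in\mathbb N}$ be an $L^2(M)$-orthonormal basis of smooth Laplace–Beltrami eigenfunctions, $-\Delta_g\varphi_j=\lambda_j^2\varphi_j$ with $\lambda_j\ge 0$ (so $\lambda_j=h_j^{-1}$ in semiclassical notation). Let $S$ be a closed (compact, without boundary) embedded submanifold of $M$ of dimension $d$, with induced Riemannian measure $d\sigma$. For $h\in(0,1]$ let $0\le a_h<b_h$, and put $$I_h=\{k: h\lambda_k\in(a_h,b_h]\},\qquad E_h=\Big\{\sum_{k\in I_h}z_k\varphi_k:\ z_k\in\mathbb C\Big\},\qquad N_h=\dim_{\mathbb C}E_h,$$ $$N(S)_h=\sum_{k\in I_h}\Big|\int_S\varphi_k\,d\sigma\Big|^2 .$$ Let $S_h$ be the $L^2$ unit sphere of $E_h$ and $\mathbf P_h$ the uniform probability measure on $S_h$, that is, the pushforward under $x\mapsto x/|x|$ of the standard Gaussian measure of $E_h\cong\mathbb R^{2N_h}$ (if $N_h=0$ the sphere is empty and nothing is claimed). For a positive integer $p$ and $u\in S_h$ let $$F_p(u)=\Big|\int_S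 u\,d\sigma\Big|^p,\qquad \tilde F_p(u)=\frac{F_p(u)}{p\,N(S)_h^{p/2}},$$ with $\tilde F_p=0$ if $N(S)_h=0$. Then for every positive integer $p$ there is a constant $C>0$, independent of $h$ and $r$, such that for all $h\in(0,1]$, every median $\tilde M_{p,h}$ of $\tilde F_p$ under $\mathbf P_h$, and all $r>0$, $$\mathbf P_h\big(|\tilde F_p(u)-\tilde M_{p,h}|>r\big)\le C\exp(-N_h r^2).$$ -/

import Mathlib

open MeasureTheory Manifold Bundle
open scoped ContDiff

noncomputable section

/-- Smooth Riemannian metrics on the `n`-dimensional manifold `M`. -/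
abbrev SmoothMetric (n : ℕ) (M : Type*) [TopologicalSpace M]
    [ChartedSpace (EuclideanSpace ℝ (Fin n)) M] [IsManifold (𝓡 n) ∞ M] :=
  ContMDiffRiemannianMetric (𝓡 n) ∞ (EuclideanSpace ℝ (Fin n))
    (fun x : M => TangentSpace (𝓡 n) x)

section RiemannianVolume

variable {n : ℕ} {M : Type*} [TopologicalSpace M] [ChartedSpace (EuclideanSpace ℝ (Fin n)) M]

/-- The coordinate vector field `∂ᵢ` of the preferred chart at `c`, at the point with
coordinates `y`. -/
def coordVec (c : M) (i : Fin n) (y : EuclideanSpace ℝ (Fin n)) :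
    TangentSpace (𝓡 n) ((chartAt (EuclideanSpace ℝ (Fin n)) c).symm y) :=
  mfderiv (𝓡 n) (𝓡 n) (chartAt (EuclideanSpace ℝ (Fin n)) c).symm y
    (EuclideanSpace.single i (1 : ℝ))

/-- The matrix `(Q(∂ᵢ, ∂ⱼ))ᵢⱼ` of a field `Q` of bilinear forms, in the preferred chart at `c`,
at the point with coordinates `y`. -/
def gramMatrix (Q : ∀ x : M, TangentSpace (𝓡 n) x → TangentSpace (𝓡 n) x → ℝ) (c : M)
    (y : EuclideanSpace ℝ (Fin n)) : Matrix (Fin n) (Fin n) ℝ :=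
  Matrix.of fun i j => Q _ (coordVec c i y) (coordVec c j y)

variable [MeasurableSpace M]

/-- The measure `√(det Qᵢⱼ) dy₁ ⋯ dyₙ` on the domain of the preferred chart at `c`, as a measure
on `M` vanishing outside that domain. -/
def chartVolume (Q : ∀ x : M, TangentSpace (𝓡 n) x → TangentSpace (𝓡 n) x → ℝ) (c : M) :
    Measure M :=
  (((volume : Measure (EuclideanSpace ℝ (Fin n))).restrict
      (chartAt (EuclideanSpace ℝ (Fin n)) c).target).withDensity
    fun y => ENNReal.ofReal (Real.sqrt (gramMatrix Q c y).det)).map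
      (chartAt (EuclideanSpace ℝ (Fin n)) c).symm

variable (n M) in
/-- A smooth partition of unity subordinate to the chart domains. -/
def chartPartition [IsManifold (𝓡 n) ∞ M] [T2Space M] [SigmaCompactSpace M] :
    SmoothPartitionOfUnity M (𝓡 n) M Set.univ :=
  (SmoothPartitionOfUnity.exists_isSubordinate_chartAt_source (𝓡 n) M).choose

/-- The Riemannian volume measure of the metric `Q`: the measure with
`∫ f = ∑_c ∫ (ρ_c f)(y) √(det Qᵢⱼ(y)) dy`, where `(ρ_c)` is a smooth partition of unity
subordinate to the chart domains. By the change of variables formula it does not depend on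
the partition of unity. -/
def metricVolume [IsManifold (𝓡 n) ∞ M] [T2Space M] [SigmaCompactSpace M]
    (Q : ∀ x : M, TangentSpace (𝓡 n) x → TangentSpace (𝓡 n) x → ℝ) : Measure M :=
  Measure.sum fun c : M =>
    (chartVolume Q c).withDensity fun x => ENNReal.ofReal (chartPartition n M c x)

/-- The Riemannian volume measure of `(M, g)`. -/
def riemannianVolume [IsManifold (𝓡 n) ∞ M] [T2Space M] [SigmaCompactSpace M]
    (g : SmoothMetric n M) : Measure M :=
  metricVolume fun x v w => g.inner x v w

/-- The measure `dσ` on `S` induced by `ι : S → M`: the Riemannian volume measure of the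
pulled back metric `ι* g`. -/
def inducedMeasure [IsManifold (𝓡 n) ∞ M] (g : SmoothMetric n M)
    (d : ℕ) {S : Type*} [TopologicalSpace S] [ChartedSpace (EuclideanSpace ℝ (Fin d)) S]
    [IsManifold (𝓡 d) ∞ S] [T2Space S] [SigmaCompactSpace S] [MeasurableSpace S]
    (ι : S → M) : Measure S :=
  metricVolume fun s v w =>
    g.inner (ι s) (mfderiv (𝓡 d) (𝓡 n) ι s v) (mfderiv (𝓡 d) (𝓡 n) ι s w)

end RiemannianVolume

section Laplacian

variable {n : ℕ} {M : Type*} [TopologicalSpace M] [ChartedSpace (EuclideanSpace ℝ (Fin n)) M]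
  [IsManifold (𝓡 n) ∞ M]

/-- The Laplace–Beltrami operator
`Δ f = (det g)^{-1/2} ∑ᵢⱼ ∂ᵢ ((det g)^{1/2} gⁱʲ ∂ⱼ f)`, computed at `x` in the preferred chart
at `x`. -/
def laplaceBeltrami (g : SmoothMetric n M) (f : M → ℂ) (x : M) : ℂ :=
  let e := chartAt (EuclideanSpace ℝ (Fin n)) x
  let G := gramMatrix (fun x v w => g.inner x v w) x
  let pd : Fin n → (EuclideanSpace ℝ (Fin n) → ℂ) → EuclideanSpace ℝ (Fin n) → ℂ :=
    fun i F y => fderiv ℝ F y (EuclideanSpace.single i (1 : ℝ))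
  (Real.sqrt (G (e x)).det)⁻¹ •
    ∑ i, ∑ j, pd i (fun y => (Real.sqrt (G y).det * (G y)⁻¹ i j) • pd j (f ∘ e.symm) y) (e x)

end Laplacian

/-- An `L²` orthonormal basis `(φⱼ)` of Laplace–Beltrami eigenfunctions, `-Δ φⱼ = λⱼ² φⱼ` with
`λⱼ ≥ 0`. In semiclassical notation `λⱼ = hⱼ⁻¹`. The basis of `L²` is `basis`, and `φ j` is the
smooth representative of `basis j`. -/
structure LaplaceEigenbasis {n : ℕ} {M : Type*} [TopologicalSpace M]
    [ChartedSpace (EuclideanSpace ℝ (Fin n)) M] [IsManifold (𝓡 n) ∞ M] [T2Space M]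
    [SigmaCompactSpace M] [MeasurableSpace M] (g : SmoothMetric n M) where
  freq : ℕ → ℝ
  φ : ℕ → M → ℂ
  basis : HilbertBasis ℕ ℂ (Lp ℂ 2 (riemannianVolume g))
  freq_nonneg : ∀ j, 0 ≤ freq j
  contMDiff : ∀ j, ContMDiff (𝓡 n) 𝓘(ℝ, ℂ) ∞ (φ j)
  eigen : ∀ j x, -laplaceBeltrami g (φ j) x = (freq j ^ 2 : ℝ) • φ j x
  coeFn_basis : ∀ j, (basis j : M → ℂ) =ᵐ[riemannianVolume g] φ j

section Sphere

variable (E : Type*) [NormedAddCommGroup E] [InnerProductSpace ℂ E] [FiniteDimensional ℂ E]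
  [MeasurableSpace E]

/-- The standard Gaussian probability measure of a finite-dimensional complex inner product space,
regarded as a real Euclidean space of twice the dimension. -/
def complexGaussian : Measure E :=
  letI : InnerProductSpace ℝ E := InnerProductSpace.rclikeToReal ℂ E
  haveI : FiniteDimensional ℝ E := FiniteDimensional.trans ℝ ℂ E
  ProbabilityTheory.stdGaussian E

/-- The uniform probability measure on the unit sphere: the pushforward of the standard Gaussian
measure under `x ↦ x / |x|` (restricted to the sphere, where it is concentrated). -/
def uniformSphere : Measure (Metric.sphere (0 : E) 1) :=
  ((complexGaussian E).map fun x => ((‖x‖⁻¹ : ℝ) : ℂ) • x).comap Subtype.val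

end Sphere

/-- `m` is a median of the real random variable `X` under `P`. -/
def IsMedian {Ω : Type*} [MeasurableSpace Ω] (P : Measure Ω) (X : Ω → ℝ) (m : ℝ) : Prop :=
  1 / 2 ≤ P {x | X x ≤ m} ∧ 1 / 2 ≤ P {x | m ≤ X x}

namespace LaplaceEigenbasis

variable {n : ℕ} {M : Type*} [TopologicalSpace M]
  [ChartedSpace (EuclideanSpace ℝ (Fin n)) M] [IsManifold (𝓡 n) ∞ M] [T2Space M]
  [SigmaCompactSpace M] [MeasurableSpace M] {g : SmoothMetric n M} (B : LaplaceEigenbasis g)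

/-- `I = {k | h hₖ⁻¹ ∈ (α, β]}`. -/
def window (h α β : ℝ) : Set ℕ := {k | h * B.freq k ∈ Set.Ioc α β}

/-- The spectral cluster `E = {∑_{k ∈ I} zₖ φₖ} ⊆ L²(M)`. -/
def cluster (h α β : ℝ) : Submodule ℂ (Lp ℂ 2 (riemannianVolume g)) :=
  Submodule.span ℂ (B.basis '' B.window h α β)

/-- `N_h = dim_ℂ E`. -/
def dimension (h α β : ℝ) : ℕ := Module.finrank ℂ (B.cluster h α β)

/-- The cluster carries its Borel sets (for the `L²` norm). -/
instance (h α β : ℝ) : MeasurableSpace (B.cluster h α β) := borel _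

/-- The `L²` unit sphere of the cluster. -/
abbrev unitSphere (h α β : ℝ) : Set (B.cluster h α β) := Metric.sphere 0 1

open Classical in
/-- The uniform probability measure `P_h` on the `L²` unit sphere of the cluster. Clusters on
compact manifolds are finite-dimensional; the value `0` for infinite-dimensional ones is only
there to make the definition total. -/
def prob (h α β : ℝ) : Measure (B.unitSphere h α β) :=
  if hE : FiniteDimensional ℂ (B.cluster h α β) then
    haveI := hE
    uniformSphere (B.cluster h α β)
  else 0

/-- The smooth function `∑_{k ∈ I} zₖ φₖ` represented by an element `u` of the cluster, where
`zₖ = ⟨φₖ, u⟩` are its coordinates. -/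
def toFun {h α β : ℝ} (u : B.cluster h α β) (x : M) : ℂ :=
  ∑ᶠ k ∈ B.window h α β, inner ℂ (B.basis k) (u : Lp ℂ 2 (riemannianVolume g)) * B.φ k x

variable (d : ℕ) {S : Type*} [TopologicalSpace S] [ChartedSpace (EuclideanSpace ℝ (Fin d)) S]
  [IsManifold (𝓡 d) ∞ S] [T2Space S] [SigmaCompactSpace S] [MeasurableSpace S] (ι : S → M)

/-- `F_p(u) = |∫_S u dσ|^p`. -/
def period (p : ℕ) {h α β : ℝ} (u : B.cluster h α β) : ℝ :=
  ‖∫ s, B.toFun u (ι s) ∂(inducedMeasure g d ι)‖ ^ p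

/-- `N(S)_h = ∑_{k ∈ I} |∫_S φₖ dσ|²`. -/
def periodWeight (h α β : ℝ) : ℝ :=
  ∑ᶠ k ∈ B.window h α β, ‖∫ s, B.φ k (ι s) ∂(inducedMeasure g d ι)‖ ^ 2

/-- The renormalized variable `F_p(u) / (p N(S)_h^{p/2})`. -/
def renormPeriod (p : ℕ) {h α β : ℝ} (u : B.cluster h α β) : ℝ :=
  B.period d ι p u / (p * B.periodWeight d ι h α β ^ ((p : ℝ) / 2))

end LaplaceEigenbasis

end

/-! On the cluster, `u ↦ ∫_S u dσ` is a linear functional, represented by a vector `W` with `‖W‖² =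
N(S)_h`. With `w = W/‖W‖`, the variable becomes `|⟨w,u⟩|^p / p`, which lies between `0` and `|⟨w,u⟩|
≤ 1` on the sphere. Everything rests on one cap estimate, `P(|⟨w,u⟩| ≥ r) ≤ (1 - r²)^(N-1) ≤
e·exp(-N r²)`; no isoperimetry or Lipschitz bound enters (`uniformSphere_cap_le`).

The cap lifts to a Gaussian cone, where two real coordinates dominate the other `2(N-1)`. The planar
tail `exp(-t/2)` is explicit, and averaging it over the other coordinates gives the power of `1 -
r²` (`complexGaussian_cone_le`).

The median `m` is handled by cases (`uniformSphere_median_concentration`). If `m ≤ r`, a deviation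
above `r` puts `u` in the cap. If `m > r`, the cap already has measure at least `1/2`, so a multiple
of its bound exceeds `1`. -/

/-! ### Finiteness of the induced measure. -/

section FiniteVolume

variable {n : ℕ} {M : Type*} [TopologicalSpace M] [ChartedSpace (EuclideanSpace ℝ (Fin n)) M]
  [IsManifold (𝓡 n) ∞ M] [T2Space M] [SigmaCompactSpace M] [MeasurableSpace M]

/-- The partition function is supported in a compact subset of the chart domain, so only the
integral of a continuous density over its compact image `K` counts, whatever happens near the chart
boundary. -/
theorem lintegral_chartPartition_lt_top [CompactSpace M] [BorelSpace M]
    {Q : ∀ x : M, TangentSpace (𝓡 n) x → TangentSpace (𝓡 n) x → ℝ} (c : M)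
    (hQ : ContinuousOn (fun y => (gramMatrix Q c y).det)
      (chartAt (EuclideanSpace ℝ (Fin n)) c).target) :
    ∫⁻ x, ENNReal.ofReal (chartPartition n M c x) ∂(chartVolume Q c) < ⊤ := by
  set e := chartAt (EuclideanSpace ℝ (Fin n)) c with he
  have hsub : tsupport (chartPartition n M c) ⊆ e.source :=
    (SmoothPartitionOfUnity.exists_isSubordinate_chartAt_source (𝓡 n) M).choose_spec c
  set K := e '' tsupport (chartPartition n M c) with hK
  have hKc : IsCompact K :=
    (isClosed_tsupport _).isCompact.image_of_continuousOn (e.continuousOn.mono hsub)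
  have hKt : K ⊆ e.target := by
    rintro _ ⟨x, hx, rfl⟩
    exact e.map_source (hsub hx)
  have hs : ContinuousOn (fun y => Real.sqrt (gramMatrix Q c y).det) e.target := hQ.sqrt
  refine (lintegral_map_le _ _).trans_lt ?_
  rw [lintegral_withDensity_eq_lintegral_mul₀']
  · calc
      _ ≤ ∫⁻ y in e.target, K.indicator
            (fun y => ENNReal.ofReal (Real.sqrt (gramMatrix Q c y).det)) y := by
          refine setLIntegral_mono' e.open_target.measurableSet fun y hy => ?_
          by_cases hyK : y ∈ K
          · rw [Set.indicator_of_mem hyK, Pi.mul_apply]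
            refine mul_le_of_le_one_right' ?_
            exact ENNReal.ofReal_le_one.2 ((chartPartition n M).le_one c _)
          · have : e.symm y ∉ tsupport (chartPartition n M c) := fun h =>
              hyK ⟨_, h, e.right_inv hy⟩
            have h0 : chartPartition n M c (e.symm y) = 0 := image_eq_zero_of_notMem_tsupport this
            rw [Pi.mul_apply]
            erw [h0]
            simp
      _ ≤ ∫⁻ y, K.indicator
            (fun y => ENNReal.ofReal (Real.sqrt (gramMatrix Q c y).det)) y :=
          setLIntegral_le_lintegral _ _
      _ = ∫⁻ y in K, ENNReal.ofReal (Real.sqrt (gramMatrix Q c y).det) :=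
          lintegral_indicator hKc.measurableSet _
      _ < ⊤ := ((hs.mono hKt).integrableOn_compact hKc).lintegral_lt_top
  · exact (hs.aemeasurable e.open_target.measurableSet).ennreal_ofReal
  · refine AEMeasurable.mono_ac (ν := volume.restrict e.target) ?_
      (withDensity_absolutelyContinuous _ _)
    refine AEMeasurable.ennreal_ofReal ?_
    refine ContinuousOn.aemeasurable ?_ e.open_target.measurableSet
    exact ((chartPartition n M c).contMDiff.continuous).comp_continuousOn e.continuousOn_symm

theorem isFiniteMeasure_metricVolume [CompactSpace M] [BorelSpace M]
    {Q : ∀ x : M, TangentSpace (𝓡 n) x → TangentSpace (𝓡 n) x → ℝ}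
    (hQ : ∀ c, ContinuousOn (fun y => (gramMatrix Q c y).det)
      (chartAt (EuclideanSpace ℝ (Fin n)) c).target) :
    IsFiniteMeasure (metricVolume Q) := by
  refine ⟨?_⟩
  have hfin : {c : M | (Function.support (chartPartition n M c)).Nonempty}.Finite :=
    (chartPartition n M).locallyFinite.finite_nonempty_of_compact
  rw [metricVolume, Measure.sum_apply _ MeasurableSet.univ]
  simp only [withDensity_apply _ MeasurableSet.univ, Measure.restrict_univ]
  rw [tsum_eq_sum (s := hfin.toFinset)]
  · exact ENNReal.sum_lt_top.2 fun c _ => lintegral_chartPartition_lt_top c (hQ c)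
  · intro c hc
    have : (chartPartition n M c : M → ℝ) = 0 := by
      simpa [Set.not_nonempty_iff_eq_empty] using hc
    simp [this]

omit [T2Space M] [SigmaCompactSpace M] [MeasurableSpace M] in
theorem isFiniteMeasure_inducedMeasure (g : SmoothMetric n M) (d : ℕ) {S : Type*}
    [TopologicalSpace S] [ChartedSpace (EuclideanSpace ℝ (Fin d)) S] [IsManifold (𝓡 d) ∞ S]
    [T2Space S] [CompactSpace S] [MeasurableSpace S] [BorelSpace S] {ι : S → M}
    (hι : ContMDiff (𝓡 d) (𝓡 n) ∞ ι) : IsFiniteMeasure (inducedMeasure g d ι) := by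
  refine isFiniteMeasure_metricVolume fun c => ?_
  set e := chartAt (EuclideanSpace ℝ (Fin d)) c
  have hesymm : ContMDiffOn (𝓡 d) (𝓡 d) ∞ e.symm e.target := contMDiffOn_chart_symm
  have hu : UniqueMDiffOn (𝓡 d) e.target := e.open_target.uniqueMDiffOn
  have hF : ContMDiffOn (𝓡 d) (𝓡 n) ∞ (ι ∘ e.symm) e.target := hι.comp_contMDiffOn hesymm
  have hvec : ∀ i : Fin d, ContMDiffOn (𝓡 d) (𝓡 n).tangent 0
      (fun y => (⟨ι (e.symm y), mfderiv (𝓡 d) (𝓡 n) ι (e.symm y) (coordVec c i y)⟩ :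
        TangentBundle (𝓡 n) M)) e.target := by
    intro i
    have h1 : ContMDiffOn (𝓡 d).tangent (𝓡 n).tangent 0
        (tangentMapWithin (𝓡 d) (𝓡 n) (ι ∘ e.symm) e.target)
        (Bundle.TotalSpace.proj ⁻¹' e.target) :=
      hF.contMDiffOn_tangentMapWithin (by simp) hu
    have h2 : ContMDiff (𝓡 d) (𝓡 d).tangent 0
        (fun y : EuclideanSpace ℝ (Fin d) =>
          (⟨y, EuclideanSpace.single i (1 : ℝ)⟩ : TangentBundle (𝓡 d) (EuclideanSpace ℝ (Fin d)))) := by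
      exact contMDiff_vectorSpace_iff_contDiff.2 contDiff_const
    -- The field `dι(∂ᵢ)` is the tangent map of `ι ∘ e.symm` applied to a constant field, hence
    -- continuous into the tangent bundle.
    refine (h1.comp h2.contMDiffOn fun y hy => hy).congr fun y hy => ?_
    have hd : mfderivWithin (𝓡 d) (𝓡 n) (ι ∘ e.symm) e.target y =
        (mfderiv (𝓡 d) (𝓡 n) ι (e.symm y)).comp (mfderiv (𝓡 d) (𝓡 d) e.symm y) := by
      rw [mfderivWithin_of_isOpen e.open_target hy]
      exact mfderiv_comp y ((hι _).mdifferentiableAt (by simp))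
        ((hesymm.contMDiffAt (e.open_target.mem_nhds hy)).mdifferentiableAt (by simp))
    simp only [Function.comp_apply, tangentMapWithin, hd]
    rfl
  refine Continuous.comp_continuousOn (g := Matrix.det) (continuous_id.matrix_det)
    (continuousOn_pi.2 fun i => continuousOn_pi.2 fun j => ?_)
  have hb : ContMDiffOn (𝓡 d) (𝓡 n) 0 (fun y => ι (e.symm y)) e.target := hF.of_le (by simp)
  have hg : ContMDiffOn (𝓡 d) ((𝓡 n).prod 𝓘(ℝ, EuclideanSpace ℝ (Fin n) →L[ℝ]
      EuclideanSpace ℝ (Fin n) →L[ℝ] ℝ)) 0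
      (fun y => TotalSpace.mk' (EuclideanSpace ℝ (Fin n) →L[ℝ] EuclideanSpace ℝ (Fin n) →L[ℝ] ℝ)
        (E := fun x : M => TangentSpace (𝓡 n) x →L[ℝ] TangentSpace (𝓡 n) x →L[ℝ] ℝ)
        (ι (e.symm y)) (g.inner (ι (e.symm y)))) e.target :=
    (g.contMDiff.of_le (by simp)).comp_contMDiffOn hb
  have := ContMDiffOn.clm_bundle_apply₂ (F₁ := EuclideanSpace ℝ (Fin n))
    (F₂ := EuclideanSpace ℝ (Fin n)) (F₃ := ℝ) (E₃ := Bundle.Trivial M ℝ) hg (hvec i) (hvec j)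
  intro y hy
  have h3 := this y hy
  rw [contMDiffWithinAt_totalSpace] at h3
  exact h3.2.continuousWithinAt

end FiniteVolume

/-! ### Explicit Gaussian integrals. -/

section GaussianTail

open ProbabilityTheory

theorem lintegral_gaussianReal_exp_neg_mul_sq {c : ℝ} (hc : 0 ≤ c) :
    ∫⁻ y, ENNReal.ofReal (Real.exp (-(c * y ^ 2) / 2)) ∂(gaussianReal 0 1) =
      ENNReal.ofReal (Real.sqrt (1 + c))⁻¹ := by
  have hint : Integrable (fun y : ℝ => Real.exp (-(c * y ^ 2) / 2)) (gaussianReal 0 1) := by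
    refine Integrable.of_bound (C := 1) (by fun_prop) (Filter.Eventually.of_forall fun y => ?_)
    rw [Real.norm_eq_abs, Real.abs_exp, Real.exp_le_one_iff]
    have := mul_nonneg hc (sq_nonneg y)
    linarith
  rw [← ofReal_integral_eq_lintegral_ofReal hint
    (Filter.Eventually.of_forall fun _ => Real.exp_nonneg _),
    integral_gaussianReal_eq_integral_smul one_ne_zero]
  congr 1
  have : ∀ y : ℝ, gaussianPDFReal 0 1 y • Real.exp (-(c * y ^ 2) / 2) =
      (Real.sqrt (2 * Real.pi))⁻¹ * Real.exp (-((1 + c) / 2) * y ^ 2) := by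
    intro y
    simp only [gaussianPDFReal, smul_eq_mul, NNReal.coe_one, mul_one, sub_zero, mul_assoc,
      ← Real.exp_add]
    ring_nf
  simp_rw [this]
  rw [integral_const_mul, integral_gaussian, ← Real.sqrt_inv, ← Real.sqrt_inv,
    ← Real.sqrt_mul (by positivity)]
  congr 1
  have := Real.pi_ne_zero
  field_simp

/-- In polar coordinates the radial density `r exp(-r²/2)` has the antiderivative `-exp(-r²/2)`, so
dimension two gives a clean exponential. -/
theorem gaussianReal_prod_tail_le (t : ℝ) (ht : 0 ≤ t) :
    ((gaussianReal 0 1).prod (gaussianReal 0 1)) {p : ℝ × ℝ | t ≤ p.1 ^ 2 + p.2 ^ 2} ≤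
      ENNReal.ofReal (Real.exp (-t / 2)) := by
  have hS : MeasurableSet {p : ℝ × ℝ | t ≤ p.1 ^ 2 + p.2 ^ 2} :=
    measurableSet_le (by fun_prop) (by fun_prop)
  have hexp : ∀ r : ℝ, HasDerivAt (fun r => -Real.exp (-r ^ 2 / 2)) (r * Real.exp (-r ^ 2 / 2)) r := by
    intro r
    have h1 : HasDerivAt (fun r : ℝ => -r ^ 2 / 2) (-r) r := by
      have := ((hasDerivAt_pow 2 r).neg).div_const 2
      convert! this using 1
      ring
    convert! h1.exp.neg using 1
    ring
  have hlim : Filter.Tendsto (fun r : ℝ => -Real.exp (-r ^ 2 / 2)) Filter.atTop (nhds 0) := by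
    rw [← neg_zero]
    refine (Real.tendsto_exp_atBot.comp ?_).neg
    have := (Filter.tendsto_neg_atTop_atBot.comp
      (Filter.tendsto_pow_atTop (α := ℝ) two_ne_zero)).atBot_div_const (two_pos)
    exact this
  have hnn : ∀ r ∈ Set.Ioi (Real.sqrt t), 0 ≤ r * Real.exp (-r ^ 2 / 2) := fun r hr =>
    mul_nonneg ((Real.sqrt_nonneg t).trans hr.le) (Real.exp_nonneg _)
  have hradial : ∫⁻ r in Set.Ioi (Real.sqrt t), ENNReal.ofReal (r * Real.exp (-r ^ 2 / 2)) =
      ENNReal.ofReal (Real.exp (-t / 2)) := by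
    rw [← ofReal_integral_eq_lintegral_ofReal
      (integrableOn_Ioi_deriv_of_nonneg' (fun r _ => hexp r) hnn hlim)
      ((ae_restrict_iff' measurableSet_Ioi).2 (Filter.Eventually.of_forall hnn)),
      integral_Ioi_of_hasDerivAt_of_nonneg' (fun r _ => hexp r) hnn hlim, Real.sq_sqrt ht]
    simp
  rw [gaussianReal_of_var_ne_zero 0 one_ne_zero, prod_withDensity (by fun_prop) (by fun_prop),
    withDensity_apply _ hS, ← lintegral_indicator hS, ← Measure.volume_eq_prod,
    ← lintegral_comp_polarCoord_symm]
  have key : ∀ p ∈ polarCoord.target, ENNReal.ofReal p.1 •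
      ({p : ℝ × ℝ | t ≤ p.1 ^ 2 + p.2 ^ 2}.indicator
        (fun z => gaussianPDF 0 1 z.1 * gaussianPDF 0 1 z.2) (polarCoord.symm p)) ≤
      ((Set.Ici (Real.sqrt t)).indicator
        (fun r => ENNReal.ofReal (r * Real.exp (-r ^ 2 / 2))) p.1) *
        ENNReal.ofReal (2 * Real.pi)⁻¹ := by
    rintro ⟨r, θ⟩ hp
    simp only [polarCoord_target, Set.mem_prod, Set.mem_Ioi] at hp
    have hr := hp.1
    have hsq : (r * Real.cos θ) ^ 2 + (r * Real.sin θ) ^ 2 = r ^ 2 := by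
      linear_combination r ^ 2 * Real.cos_sq_add_sin_sq θ
    simp only [polarCoord_symm_apply]
    by_cases h : t ≤ r ^ 2
    · rw [Set.indicator_of_mem (by simpa only [Set.mem_ofPred_eq, hsq] using h),
        Set.indicator_of_mem (by
          rw [Set.mem_Ici, Real.sqrt_le_left hr.le]; exact h)]
      rw [gaussianPDF, gaussianPDF, ← ENNReal.ofReal_mul (gaussianPDFReal_nonneg _ _ _),
        smul_eq_mul, ← ENNReal.ofReal_mul hr.le,
        ← ENNReal.ofReal_mul (mul_nonneg hr.le (Real.exp_nonneg _))]
      apply le_of_eq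
      congr 1
      simp only [gaussianPDFReal, NNReal.coe_one, mul_one, sub_zero]
      have e1 : Real.exp (-r ^ 2 / 2) = Real.exp (-(r * Real.cos θ) ^ 2 / 2) *
          Real.exp (-(r * Real.sin θ) ^ 2 / 2) := by
        rw [← Real.exp_add, ← hsq]; ring_nf
      have e2 : (2 * Real.pi)⁻¹ = (Real.sqrt (2 * Real.pi))⁻¹ * (Real.sqrt (2 * Real.pi))⁻¹ := by
        rw [← mul_inv, Real.mul_self_sqrt (by positivity)]
      rw [e1, e2]; ring
    · rw [Set.indicator_of_notMem (by simpa only [Set.mem_ofPred_eq, hsq] using h)]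
      simp
  refine (setLIntegral_mono' polarCoord.open_target.measurableSet key).trans ?_
  have hmeas : Measurable ((Set.Ici (Real.sqrt t)).indicator
        (fun r : ℝ => ENNReal.ofReal (r * Real.exp (-r ^ 2 / 2)))) :=
    Measurable.indicator (by fun_prop) measurableSet_Ici
  rw [polarCoord_target, Measure.volume_eq_prod, ← Measure.prod_restrict,
    lintegral_prod_mul hmeas.aemeasurable aemeasurable_const]
  simp only [lintegral_const, Measure.restrict_apply_univ, Real.volume_Ioo]
  rw [← ENNReal.ofReal_mul (by positivity)]
  have : (2 * Real.pi)⁻¹ * (Real.pi - -Real.pi) = 1 := by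
    have := Real.pi_ne_zero
    field_simp; norm_num
  rw [this, ENNReal.ofReal_one, mul_one]
  refine (setLIntegral_le_lintegral _ _).trans ?_
  rw [lintegral_indicator measurableSet_Ici, setLIntegral_congr Ioi_ae_eq_Ici.symm, hradial]

/-- Freezing the coordinates in `κ` leaves a planar tail at `t = c ∑ yₖ²`; the resulting exponential
factors over `k`, and independence reduces its mean to one-dimensional integrals. -/
theorem pi_gaussianReal_ratio_le (κ : Type*) [Fintype κ] {c : ℝ} (hc : 0 ≤ c) :
    Measure.pi (fun _ : Fin 2 ⊕ κ => gaussianReal 0 1)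
      {x | c * ∑ k, x (Sum.inr k) ^ 2 ≤ x (Sum.inl 0) ^ 2 + x (Sum.inl 1) ^ 2} ≤
      ENNReal.ofReal (Real.sqrt (1 + c))⁻¹ ^ Fintype.card κ := by
  have h1 := measurePreserving_sumPiEquivProdPi (fun _ : Fin 2 ⊕ κ => gaussianReal 0 1)
  have h2 := (measurePreserving_finTwoArrow (gaussianReal 0 1))
  have hμ := (h2.prod (MeasurePreserving.id (Measure.pi fun _ : κ => gaussianReal 0 1))).comp h1
  set A : Set ((ℝ × ℝ) × (κ → ℝ)) := {z | c * ∑ k, z.2 k ^ 2 ≤ z.1.1 ^ 2 + z.1.2 ^ 2} with hA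
  have hAm : MeasurableSet A := measurableSet_le (by fun_prop) (by fun_prop)
  have := hμ.measure_preimage hAm.nullMeasurableSet
  refine (le_of_eq this).trans ?_
  rw [Measure.prod_apply_symm hAm]
  calc
    _ ≤ ∫⁻ y : κ → ℝ, ∏ k, ENNReal.ofReal (Real.exp (-(c * y k ^ 2) / 2))
          ∂(Measure.pi fun _ : κ => gaussianReal 0 1) := by
        refine lintegral_mono fun y => ?_
        refine (gaussianReal_prod_tail_le (c * ∑ k, y k ^ 2) (by positivity)).trans ?_
        rw [← ENNReal.ofReal_prod_of_nonneg (fun _ _ => Real.exp_nonneg _), ← Real.exp_sum,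
          ← Finset.sum_div, Finset.sum_neg_distrib, Finset.mul_sum]
    _ = _ := by
        have hm : ∀ k : κ, Measurable fun y : κ → ℝ =>
            ENNReal.ofReal (Real.exp (-(c * y k ^ 2) / 2)) := fun k => by fun_prop
        rw [lintegral_prod_eq_prod_lintegral_of_indepFun Finset.univ
          (fun k (y : κ → ℝ) => ENNReal.ofReal (Real.exp (-(c * y k ^ 2) / 2)))
          (iIndepFun_pi (X := fun _ x => ENNReal.ofReal (Real.exp (-(c * x ^ 2) / 2)))
            fun _ => by fun_prop) hm]
        have : ∀ k : κ, ∫⁻ y : κ → ℝ, ENNReal.ofReal (Real.exp (-(c * y k ^ 2) / 2))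
            ∂(Measure.pi fun _ : κ => gaussianReal 0 1) =
            ∫⁻ y, ENNReal.ofReal (Real.exp (-(c * y ^ 2) / 2)) ∂(gaussianReal 0 1) := fun k =>
          (measurePreserving_eval (fun _ : κ => gaussianReal 0 1) k).lintegral_comp
            (f := fun y => ENNReal.ofReal (Real.exp (-(c * y ^ 2) / 2))) (by fun_prop)
        simp [this, lintegral_gaussianReal_exp_neg_mul_sq hc]

end GaussianTail

/-! ### Caps and medians on the complex sphere. -/

section SphereTail

open ProbabilityTheory Module

variable {E : Type*} [NormedAddCommGroup E] [InnerProductSpace ℂ E] [FiniteDimensional ℂ E]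
  [MeasurableSpace E] [BorelSpace E]

theorem complexGaussian_cone_le {w : E} (hw : ‖w‖ = 1) {r : ℝ} (hr0 : 0 ≤ r) (hr1 : r < 1) :
    complexGaussian E {x | r * ‖x‖ ≤ ‖inner ℂ w x‖} ≤
      ENNReal.ofReal (Real.exp 1 * Real.exp (-(finrank ℂ E : ℝ) * r ^ 2)) := by
  let : InnerProductSpace ℝ E := InnerProductSpace.rclikeToReal ℂ E
  have : FiniteDimensional ℝ E := FiniteDimensional.trans ℝ ℂ E
  have hre : ∀ x y : E, inner ℝ x y = (inner ℂ x y).re := fun x y => rfl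
  have hN : 1 ≤ finrank ℂ E := by
    have : Nontrivial E := ⟨⟨w, 0, by rintro rfl; simp at hw⟩⟩
    exact finrank_pos
  set N := finrank ℂ E with hNdef
  have hrank : finrank ℝ E = 2 * N := by
    rw [← finrank_mul_finrank ℝ ℂ E, Complex.finrank_real_complex]
  -- For the real inner product `Re⟨·,·⟩`, the vectors `w` and `i w` are orthonormal and read off
  -- the real and imaginary parts of `⟨w,x⟩`. The zeros are placeholders, replaced when the pair is
  -- extended to a basis.
  let v : Fin 2 ⊕ Fin (2 * (N - 1)) → E := Sum.elim ![w, Complex.I • w] 0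
  have hww : inner ℂ w w = (1 : ℂ) := by simp [inner_self_eq_norm_sq_to_K, hw]
  have hv : Orthonormal ℝ ((Set.range Sum.inl).domRestrict v) := by
    refine ⟨?_, ?_⟩
    · rintro ⟨_, i, rfl⟩
      fin_cases i <;> simp [v, Set.domRestrict, norm_smul, hw]
    · rintro ⟨_, i, rfl⟩ ⟨_, j, rfl⟩ hij
      fin_cases i <;> fin_cases j <;>
        simp_all [v, Set.domRestrict]
  obtain ⟨b, hb⟩ := hv.exists_orthonormalBasis_extension_of_card_eq (by
    rw [hrank]; simp; omega)
  have hb0 : b (Sum.inl 0) = w := hb _ ⟨0, rfl⟩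
  have hb1 : b (Sum.inl 1) = Complex.I • w := hb _ ⟨1, rfl⟩
  have hsq : r ^ 2 < 1 := by nlinarith
  -- With `A = |⟨w,x⟩|²` and `R` the sum of the other squares, `r²(A + R) ≤ A` means `c R ≤ A`.
  set c := r ^ 2 / (1 - r ^ 2) with hc
  have hc0 : 0 ≤ c := div_nonneg (sq_nonneg r) (by linarith)
  have hG : complexGaussian E = (Measure.pi fun _ => gaussianReal 0 1).map
      (fun x => ∑ i, x i • b i) := stdGaussian_eq_map_pi_orthonormalBasis b
  have hm : MeasurableSet {x : E | r * ‖x‖ ≤ ‖inner ℂ w x‖} :=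
    (isClosed_le (by fun_prop) (by fun_prop)).measurableSet
  rw [hG, Measure.map_apply (by fun_prop) hm]
  refine (measure_mono (t := {x | c * ∑ k, x (Sum.inr k) ^ 2 ≤
    x (Sum.inl 0) ^ 2 + x (Sum.inl 1) ^ 2}) ?_).trans
    ((pi_gaussianReal_ratio_le _ hc0).trans ?_)
  · intro x hx
    set u := ∑ i, x i • b i with hu
    have hcoord : ∀ i, inner ℝ (b i) u = x i := fun i =>
      b.orthonormal.inner_right_fintype x i
    have hnorm : ‖u‖ ^ 2 = ∑ i, x i ^ 2 := by
      rw [← b.sum_sq_inner_right u]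
      simp_rw [hcoord]
    have h0 : (inner ℂ w u).re = x (Sum.inl 0) := by
      rw [← hcoord, hb0, hre]
    have h1 : (inner ℂ w u).im = x (Sum.inl 1) := by
      rw [← hcoord, hb1, hre, inner_smul_left]
      simp
    have hx' : r * ‖u‖ ≤ ‖inner ℂ w u‖ := hx
    have h2 : r ^ 2 * ‖u‖ ^ 2 ≤ ‖inner ℂ w u‖ ^ 2 := by
      rw [← mul_pow]
      exact pow_le_pow_left₀ (by positivity) hx' 2
    rw [Complex.sq_norm, Complex.normSq_apply, h0, h1, hnorm, Fintype.sum_sum_type,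
      Fin.sum_univ_two] at h2
    rw [Set.mem_ofPred_eq, hc, div_mul_eq_mul_div, div_le_iff₀ (by linarith)]
    linarith
  · rw [← ENNReal.ofReal_pow (by positivity)]
    refine ENNReal.ofReal_le_ofReal ?_
    have h1c : 1 + c = (1 - r ^ 2)⁻¹ := by
      rw [hc]; field_simp [(by linarith : (1 - r ^ 2) ≠ 0)]; ring
    rw [Fintype.card_fin, pow_mul, inv_pow, Real.sq_sqrt (by linarith), h1c, inv_inv,
      ← Real.exp_add]
    calc (1 - r ^ 2) ^ (N - 1) ≤ Real.exp (-r ^ 2) ^ (N - 1) := by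
          refine pow_le_pow_left₀ (by linarith) ?_ _
          have := Real.add_one_le_exp (-r ^ 2)
          linarith
      _ = Real.exp ((N - 1 : ℕ) * (-r ^ 2)) := (Real.exp_nat_mul _ _).symm
      -- The factor `e` pays for the exponent `N - 1` in place of `N`, since `r² < 1`.
      _ ≤ _ := by
          rw [Nat.cast_sub hN]
          refine Real.exp_le_exp.2 ?_
          push_cast
          linarith

theorem uniformSphere_apply_le {A : Set (Metric.sphere (0 : E) 1)} (hA : IsClosed A)
    {T : Set E} (hT : ∀ x : E, ∀ h, (⟨((‖x‖⁻¹ : ℝ) : ℂ) • x, h⟩ : Metric.sphere (0 : E) 1) ∈ A →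
      x ∈ T) :
    uniformSphere E A ≤ complexGaussian E T := by
  have hcl : IsClosed (Subtype.val '' A : Set E) :=
    Metric.isClosed_sphere.isClosedEmbedding_subtypeVal.isClosedMap _ hA
  rw [uniformSphere, (MeasurableEmbedding.subtype_coe
    Metric.isClosed_sphere.measurableSet).comap_apply, Measure.map_apply (by fun_prop)
    hcl.measurableSet]
  refine measure_mono ?_
  rintro x ⟨⟨y, hy⟩, hyA, hyx⟩
  subst hyx
  exact hT x hy hyA

instance isProbabilityMeasure_complexGaussian : IsProbabilityMeasure (complexGaussian E) := by
  let : InnerProductSpace ℝ E := InnerProductSpace.rclikeToReal ℂ E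
  have : FiniteDimensional ℝ E := FiniteDimensional.trans ℝ ℂ E
  exact isProbabilityMeasure_stdGaussian

/-- An upper bound on the total mass suffices, so the Gaussian measure of the origin need not be
computed. -/
theorem uniformSphere_le_one (A : Set (Metric.sphere (0 : E) 1)) : uniformSphere E A ≤ 1 :=
  (measure_mono (Set.subset_univ A)).trans
    ((uniformSphere_apply_le (T := Set.univ) isClosed_univ fun _ _ _ => trivial).trans
      prob_le_one)

theorem uniformSphere_cap_le {w : E} (hw : ‖w‖ = 1) {r : ℝ} (hr0 : 0 ≤ r) (hr1 : r < 1) :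
    uniformSphere E {u | r ≤ ‖inner ℂ w u.1‖} ≤
      ENNReal.ofReal (Real.exp 1 * Real.exp (-(finrank ℂ E : ℝ) * r ^ 2)) := by
  refine (uniformSphere_apply_le (isClosed_le (by fun_prop) (by fun_prop)) ?_).trans
    (complexGaussian_cone_le hw hr0 hr1)
  intro x hx h
  have h' : r ≤ ‖inner ℂ w (((‖x‖⁻¹ : ℝ) : ℂ) • x)‖ := h
  have hx0 : x ≠ 0 := by
    rintro rfl
    simp at hx
  have hpos := norm_pos_iff.2 hx0
  rw [inner_smul_right, norm_mul, Complex.norm_real, norm_inv, norm_norm,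
    le_inv_mul_iff₀ hpos] at h'
  rw [Set.mem_ofPred_eq]
  linarith

theorem uniformSphere_median_concentration {w : E} (hw : ‖w‖ = 1) {p : ℕ} (hp : 0 < p)
    {m : ℝ} (hm : IsMedian (uniformSphere E) (fun u => ‖inner ℂ w u.1‖ ^ p / p) m)
    {r : ℝ} (hr : 0 < r) :
    (uniformSphere E).real {u | r < |‖inner ℂ w u.1‖ ^ p / p - m|} ≤
      3 * Real.exp 1 * Real.exp (-(finrank ℂ E : ℝ) * r ^ 2) := by
  have hle1 : ∀ u : Metric.sphere (0 : E) 1, ‖inner ℂ w u.1‖ ≤ 1 := fun u => by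
    refine (norm_inner_le_norm _ _).trans ?_
    rw [hw, norm_eq_of_mem_sphere u, one_mul]
  have hXle : ∀ u : Metric.sphere (0 : E) 1,
      ‖inner ℂ w u.1‖ ^ p / p ≤ ‖inner ℂ w u.1‖ := fun u => by
    have h1 : (1 : ℝ) ≤ p := by exact_mod_cast hp
    exact (div_le_self (by positivity) h1).trans
      (pow_le_of_le_one (norm_nonneg _) (hle1 u) hp.ne')
  have hX0 : ∀ u : Metric.sphere (0 : E) 1, 0 ≤ ‖inner ℂ w u.1‖ ^ p / (p : ℝ) := fun u => by
    positivity
  have hm0 : 0 ≤ m := by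
    obtain ⟨u, hu⟩ : {u : Metric.sphere (0 : E) 1 | ‖inner ℂ w u.1‖ ^ p / p ≤ m}.Nonempty := by
      refine nonempty_of_measure_ne_zero (μ := uniformSphere E) fun h => ?_
      have := hm.1
      rw [h] at this
      simp at this
    exact (hX0 u).trans hu
  set q := Real.exp 1 * Real.exp (-(finrank ℂ E : ℝ) * r ^ 2) with hq
  have hq0 : 0 ≤ q := by positivity
  rw [mul_assoc, ← hq]
  refine ENNReal.toReal_le_of_le_ofReal (by positivity) ?_
  rcases lt_or_ge r m with hrm | hmr
  -- Half the mass has variable at least `m > r`, hence lies in the cap. So `q ≥ 1/2`, and the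
  -- trivial bound `1 ≤ 2q` is enough.
  · have hmed : (1 / 2 : ENNReal) ≤ ENNReal.ofReal q := by
      obtain ⟨u, hu⟩ : {u : Metric.sphere (0 : E) 1 |
          m ≤ ‖inner ℂ w u.1‖ ^ p / p}.Nonempty := by
        refine nonempty_of_measure_ne_zero (μ := uniformSphere E) fun h => ?_
        have := hm.2
        rw [h] at this
        simp at this
      have hr1 : r < 1 := hrm.trans_le ((Set.mem_ofPred_eq ▸ hu).trans ((hXle u).trans (hle1 u)))
      exact hm.2.trans ((measure_mono fun u hu =>
        hrm.le.trans (le_trans hu (hXle u))).trans (uniformSphere_cap_le hw hr.le hr1))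
    calc _ ≤ (1 : ENNReal) := uniformSphere_le_one _
      _ = 1 / 2 + 1 / 2 := (ENNReal.add_halves 1).symm
      _ ≤ ENNReal.ofReal q + ENNReal.ofReal q := add_le_add hmed hmed
      _ = ENNReal.ofReal (q + q) := (ENNReal.ofReal_add hq0 hq0).symm
      _ ≤ _ := ENNReal.ofReal_le_ofReal (by linarith)
  -- Here `0 ≤ m ≤ r` rules out deviations below `m`; those above force `|⟨w,u⟩| > r`.
  · have hsub : ∀ u : Metric.sphere (0 : E) 1, r < |‖inner ℂ w u.1‖ ^ p / p - m| →
        r < ‖inner ℂ w u.1‖ := by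
      intro u hu
      rcases lt_abs.1 hu with h | h
      · linarith [hXle u]
      · linarith [hX0 u]
    rcases lt_or_ge r 1 with hr1 | hr1
    · refine (measure_mono fun u hu => (hsub u hu).le).trans
        ((uniformSphere_cap_le hw hr.le hr1).trans (ENNReal.ofReal_le_ofReal ?_))
      linarith
    · have : {u : Metric.sphere (0 : E) 1 | r < |‖inner ℂ w u.1‖ ^ p / p - m|} = ∅ := by
        refine Set.eq_empty_of_forall_notMem fun u hu => ?_
        linarith [hsub u hu, hle1 u]
      rw [this, measure_empty]
      exact zero_le

theorem uniformSphere_median_concentration_of_ne_zero {W : E} (hW : W ≠ 0) {p : ℕ} (hp : 0 < p)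
    {m : ℝ} (hm : IsMedian (uniformSphere E) (fun u => ‖inner ℂ W u.1‖ ^ p / (p * ‖W‖ ^ p)) m)
    {r : ℝ} (hr : 0 < r) :
    (uniformSphere E).real {u | r < |‖inner ℂ W u.1‖ ^ p / (p * ‖W‖ ^ p) - m|} ≤
      3 * Real.exp 1 * Real.exp (-(finrank ℂ E : ℝ) * r ^ 2) := by
  have hpos : 0 < ‖W‖ := norm_pos_iff.2 hW
  have hw : ‖((‖W‖⁻¹ : ℝ) : ℂ) • W‖ = 1 := by
    rw [norm_smul, Complex.norm_real, norm_inv, norm_norm, inv_mul_cancel₀ hpos.ne']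
  have hX : ∀ u : E, ‖inner ℂ W u‖ ^ p / (p * ‖W‖ ^ p) =
      ‖inner ℂ (((‖W‖⁻¹ : ℝ) : ℂ) • W) u‖ ^ p / p := by
    intro u
    rw [inner_smul_left, norm_mul, RCLike.norm_conj, Complex.norm_real, norm_inv, norm_norm,
      mul_pow, inv_pow]
    field_simp
  simp only [hX] at hm ⊢
  exact uniformSphere_median_concentration hw hp hm hr

end SphereTail

/-! ### The period functional on a spectral cluster. -/

namespace LaplaceEigenbasis

variable {n : ℕ} {M : Type*} [TopologicalSpace M]
  [ChartedSpace (EuclideanSpace ℝ (Fin n)) M] [IsManifold (𝓡 n) ∞ M] [T2Space M]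
  [SigmaCompactSpace M] [MeasurableSpace M] {g : SmoothMetric n M} (B : LaplaceEigenbasis g)

/-- Needed so that the `finsum`s over the window are genuine finite sums. -/
theorem finite_window {h α β : ℝ} [FiniteDimensional ℂ (B.cluster h α β)] :
    (B.window h α β).Finite := by
  let f : B.window h α β → B.cluster h α β := fun k =>
    ⟨B.basis k, Submodule.subset_span ⟨k, k.2, rfl⟩⟩
  have hf : LinearIndependent ℂ f := by
    refine LinearIndependent.of_comp (B.cluster h α β).subtype ?_
    exact B.basis.orthonormal.linearIndependent.comp _ Subtype.val_injective
  exact Set.finite_coe_iff.1 hf.finite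

variable {d : ℕ} {S : Type*} [TopologicalSpace S] [ChartedSpace (EuclideanSpace ℝ (Fin d)) S]
  [IsManifold (𝓡 d) ∞ S] [T2Space S] [CompactSpace S] [MeasurableSpace S] [BorelSpace S]
  {ι : S → M}

/-- The period functional `u ↦ ∫_S u dσ` on a finite-dimensional cluster is represented by a vector
whose squared norm is `N(S)_h`. -/
theorem exists_integral_toFun_eq_inner (hι : ContMDiff (𝓡 d) (𝓡 n) ∞ ι) {h α β : ℝ}
    [FiniteDimensional ℂ (B.cluster h α β)] :
    ∃ W : B.cluster h α β,
      (∀ u : B.cluster h α β,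
        ∫ s, B.toFun u (ι s) ∂(inducedMeasure g d ι) = inner ℂ W u) ∧
      B.periodWeight d ι h α β = ‖W‖ ^ 2 := by
  have hfin := B.finite_window (h := h) (α := α) (β := β)
  have := isFiniteMeasure_inducedMeasure g d hι
  set I : ℕ → ℂ := fun k => ∫ s, B.φ k (ι s) ∂(inducedMeasure g d ι) with hI
  have hint : ∀ k, Integrable (fun s => B.φ k (ι s)) (inducedMeasure g d ι) := fun k =>
    ((B.contMDiff k).continuous.comp hι.continuous).integrable_of_hasCompactSupport
      (HasCompactSupport.of_compactSpace _)
  -- The coefficients are conjugated because the inner product is conjugate-linear in its first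
  -- argument.
  let W : B.cluster h α β := ⟨∑ k ∈ hfin.toFinset, starRingEnd ℂ (I k) • B.basis k,
    Submodule.sum_mem _ fun k hk => Submodule.smul_mem _ _
      (Submodule.subset_span ⟨k, hfin.mem_toFinset.1 hk, rfl⟩)⟩
  refine ⟨W, fun u => ?_, ?_⟩
  · have hfun : ∀ s, B.toFun u (ι s) = ∑ k ∈ hfin.toFinset,
        inner ℂ (B.basis k) (u : Lp ℂ 2 (riemannianVolume g)) * B.φ k (ι s) := fun s =>
      finsum_mem_eq_finite_toFinset_sum _ hfin
    simp_rw [hfun]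
    rw [integral_finsetSum _ fun k _ => (hint k).const_mul _, Submodule.coe_inner, sum_inner]
    refine Finset.sum_congr rfl fun k _ => ?_
    rw [integral_const_mul, inner_smul_left, RingHomCompTriple.comp_apply, RingHom.id_apply,
      mul_comm]
  · have hW : inner ℂ (W : Lp ℂ 2 (riemannianVolume g)) W = ((‖W‖ ^ 2 : ℝ) : ℂ) := by
      rw [inner_self_eq_norm_sq_to_K]
      norm_cast
    have hsum : inner ℂ (W : Lp ℂ 2 (riemannianVolume g)) W =
        ((∑ k ∈ hfin.toFinset, ‖I k‖ ^ 2 : ℝ) : ℂ) := by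
      refine (B.basis.orthonormal.inner_sum _ _ _).trans ?_
      rw [Complex.ofReal_sum]
      refine Finset.sum_congr rfl fun k _ => ?_
      rw [RCLike.conj_mul]
      simp
    rw [periodWeight, finsum_mem_eq_finite_toFinset_sum _ hfin]
    exact_mod_cast hsum.symm.trans hW

omit [BorelSpace S] in
theorem renormPeriod_eq_zero {p : ℕ} (hp : 0 < p) {h α β : ℝ}
    (h0 : B.periodWeight d ι h α β = 0) (u : B.cluster h α β) :
    B.renormPeriod d ι p u = 0 := by
  have : (p : ℝ) / 2 ≠ 0 := by positivity
  rw [renormPeriod, h0, Real.zero_rpow this, mul_zero, div_zero]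

end LaplaceEigenbasis

theorem IsMedian.eq_of_const {Ω : Type*} [MeasurableSpace Ω] {P : Measure Ω} {a m : ℝ}
    (hm : IsMedian P (fun _ => a) m) : m = a := by
  have h1 : {x : Ω | a ≤ m}.Nonempty := nonempty_of_measure_ne_zero (μ := P) fun h => by
    have := hm.1
    rw [h] at this
    simp at this
  have h2 : {x : Ω | m ≤ a}.Nonempty := nonempty_of_measure_ne_zero (μ := P) fun h => by
    have := hm.2
    rw [h] at this
    simp at this
  exact le_antisymm h2.some_mem h1.some_mem

theorem mainTheorem5 {n d : ℕ}
    {M : Type*} [TopologicalSpace M] [T2Space M] [CompactSpace M]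
    [ChartedSpace (EuclideanSpace ℝ (Fin n)) M] [IsManifold (𝓡 n) ∞ M]
    [MeasurableSpace M] [BorelSpace M]
    (g : SmoothMetric n M)
    {S : Type*} [TopologicalSpace S] [T2Space S] [CompactSpace S]
    [ChartedSpace (EuclideanSpace ℝ (Fin d)) S] [IsManifold (𝓡 d) ∞ S]
    [MeasurableSpace S] [BorelSpace S]
    (ι : S → M) (hι : IsSmoothEmbedding (𝓡 d) (𝓡 n) ∞ ι)
    (B : LaplaceEigenbasis g)
    (a b : ℝ → ℝ) (hab : ∀ h ∈ Set.Ioc (0 : ℝ) 1, 0 ≤ a h ∧ a h < b h)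
    (p : ℕ) (hp : 0 < p) :
    ∃ C : ℝ, 0 < C ∧ ∀ h ∈ Set.Ioc (0 : ℝ) 1, ∀ m : ℝ,
      IsMedian (B.prob h (a h) (b h)) (fun u => B.renormPeriod d ι p u.1) m →
      ∀ r : ℝ, 0 < r →
        (B.prob h (a h) (b h)).real {u | r < |B.renormPeriod d ι p u.1 - m|} ≤
          C * Real.exp (-(B.dimension h (a h) (b h) : ℝ) * r ^ 2) := by
  refine ⟨3 * Real.exp 1, by positivity, fun h _ m hm r hr => ?_⟩
  by_cases hE : FiniteDimensional ℂ (B.cluster h (a h) (b h))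
  -- In infinite dimension `prob` is the zero measure, so the bound is trivial.
  swap
  · rw [LaplaceEigenbasis.prob, dif_neg hE]
    simp only [measureReal_zero_apply]
    positivity
  have : BorelSpace (B.cluster h (a h) (b h)) := ⟨rfl⟩
  rw [LaplaceEigenbasis.prob, dif_pos hE] at hm ⊢
  obtain ⟨W, hW, hN⟩ := B.exists_integral_toFun_eq_inner (d := d) hι.contMDiff
    (h := h) (α := a h) (β := b h)
  rcases eq_or_ne W 0 with rfl | hW0
  -- When `N(S)_h = 0`, division by zero gives the value `0` that the convention asks for; the
  -- median is then `0` and the event is empty.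
  · have hX := B.renormPeriod_eq_zero (d := d) (ι := ι) hp (hN.trans (by simp))
    simp only [hX] at hm ⊢
    rw [hm.eq_of_const]
    simp only [sub_self, abs_zero, not_lt_of_gt hr]
    simp only [Set.ofPred_false, measureReal_empty]
    positivity
  · have hX : ∀ u : B.cluster h (a h) (b h), B.renormPeriod d ι p u =
        ‖inner ℂ W u‖ ^ p / (p * ‖W‖ ^ p) := by
      intro u
      have hpow : (‖W‖ ^ 2) ^ ((p : ℝ) / 2) = ‖W‖ ^ p := by
        rw [← Real.rpow_natCast, ← Real.rpow_natCast, ← Real.rpow_mul (norm_nonneg W)]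
        congr 1
        push_cast
        ring
      rw [LaplaceEigenbasis.renormPeriod, LaplaceEigenbasis.period, hW, hN, hpow]
    simp only [hX] at hm ⊢
    exact uniformSphere_median_concentration_of_ne_zero hW0 hp hm hr
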